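/- Let $X$ be a Polish space with its Borel $\sigma$-algebra and a $\sigma$-finite measure $\sigma$. Let $\Omega^X$ be the space of configurations on $X$, i.e. of locally finite subsets $\omega\subset X$, each identified with the Radon point measure $\omega(dx)=\sum_{x\in\omega}\epsilon_x(dx)$, equipped with the $\sigma$-algebra $\mathcal F$ generated by the counting maps $\omega\mapsto\omega(A)$, $A\in\mathcal B(X)$. Let $P$ be a probability measure on $(\Omega^X,\mathcal F)$ with expectation $\mathbb E$, and assume that $P$ has a Papangelou density with respect to $\sigma$, i.e. that there is a measurable $c:X\times\Omega^X\to[0,\infty)$ such that the Campbell measure of $P$ satisfies $$\mathbb E\left[\int_X \mathbf 1_A(x)\mathbf 1_B(\omega\setminus\{x\})\,\omega(dx)\right]=\int_{A\times B}c(x,\omega)\,\sigma(dx)\,P(d\omega),\qquad A\in\mathcal B(X),\ B\in\mathcal F .$$ (The Poisson point process with diffuse intensity $\sigma$, finite on a neighbourhood of every point, is the case $c=1$.) For $\mathfrak x_k=(x_1,\dots,x_k)\in X^k$ write $(\varepsilon^+_{\mathfrak x_k}F)(\omega)=F(\omega\cup\{x_1,\dots,x_k\})$ for $F$ a function on $\Omega^X$,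 and $$\hat c(\mathfrak x_k,\omega)=c(x_1,\omega)\,c(x_2,\omega\cup\{x_1\})\cdots c(x_k,\omega\cup\{x_1,\dots,x_{k-1}\}).$$ **Proposition.** Let $u:X\times\Omega^X\to\mathbb R$ be measurable and let $n\ge 1$ be such that, for every partition $\{B_1,\dots,B_k\}$ of $\{1,\dots,n\}$ into non-empty blocks, the function $$(\mathfrak x_k,\omega)\mapsto \varepsilon^+_{\mathfrak x_k}\big(u(x_1,\cdot)^{|B_1|}\cdots u(x_k,\cdot)^{|B_k|}\big)(\omega)\;\hat c(\mathfrak x_k,\omega)$$ is integrable with respect to $\sigma^{k}\otimes P$. Then $u(\cdot,\omega)$ is $\omega(dx)$-integrable for $P$-almost every $\omega$, the random variable $\left(\int_X u(x,\omega)\,\omega(dx)\right)^n$ is $P$-integrable, and $$\mathbb E\left[\left(\int_X u(x,\omega)\,\omega(dx)\right)^n\right]=\sum_{k=1}^n\ \sum_{\{B_1,\dots,B_k\}}\mathbb E\left[\int_{X^k}\varepsilon^+_{\mathfrak x_k}\big(u(x_1,\cdot)^{|B_1|}\cdots u(x_k,\cdot)^{|B_k|}\big)(\omega)\;\hat c(\mathfrak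 x_k,\omega)\,\sigma(dx_1)\cdots\sigma(dx_k)\right],$$ where the inner sum runs over the partitions of $\{1,\dots,n\}$ into $k$ non-empty blocks. -/

import Mathlib

open MeasureTheory Topology
open scoped ENNReal NNReal

namespace PointConfig

/-- A configuration on `X`: a locally finite set of points. On a metrizable space this is the same
as a set having finitely many points in every compact set, i.e. a set `ω` such that the point
measure `∑_{x ∈ ω} ε_x` is Radon. -/
@[ext]
structure Config (X : Type*) [TopologicalSpace X] where
  /-- the points of the configuration -/
  carrier : Set X
  locallyFinite : ∀ x : X, ∃ U ∈ 𝓝 x, (carrier ∩ U).Finite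

namespace Config

variable {X : Type*} [TopologicalSpace X]

/-- The point measure `∑_{x ∈ ω} ε_x` identified with the configuration `ω`. -/
noncomputable def toMeasure [MeasurableSpace X] (ω : Config X) : Measure X :=
  Measure.sum fun x : ω.carrier => Measure.dirac (x : X)

/-- The σ-algebra on the configuration space, generated by the counting maps `ω ↦ ω(A)` for
`A ⊆ X` measurable (the σ-algebra on `Measure X` is the one generated by `μ ↦ μ A`). -/
noncomputable instance instMeasurableSpace [MeasurableSpace X] : MeasurableSpace (Config X) :=
  MeasurableSpace.comap toMeasure inferInstance

/-- `ω ∪ {x_i : i ∈ ι}`, for a finite family of points. -/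
def addPoints {ι : Type*} [Finite ι] (ω : Config X) (x : ι → X) : Config X where
  carrier := ω.carrier ∪ Set.range x
  locallyFinite y := by
    obtain ⟨U, hU, hf⟩ := ω.locallyFinite y
    refine ⟨U, hU, ?_⟩
    rw [Set.union_inter_distrib_right]
    exact hf.union ((Set.finite_range x).inter_of_left U)

/-- `ω \ {x}`. -/
def erase (ω : Config X) (x : X) : Config X where
  carrier := ω.carrier \ {x}
  locallyFinite y := by
    obtain ⟨U, hU, hf⟩ := ω.locallyFinite y
    exact ⟨U, hU, hf.subset (Set.inter_subset_inter_left U Set.sdiff_subset)⟩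

end Config

variable {X : Type*} [TopologicalSpace X]

/-- The operator `ε⁺_{x_1,…,x_k}`: `(ε⁺ F)(ω) = F (ω ∪ {x_1,…,x_k})`. -/
def epsPlus {ι α : Type*} [Finite ι] (x : ι → X) (F : Config X → α) (ω : Config X) : α :=
  F (ω.addPoints x)

/-- The compound Campbell density
`ĉ((x_1,…,x_k), ω) = c(x_1, ω) c(x_2, ω ∪ {x_1}) ⋯ c(x_k, ω ∪ {x_1,…,x_{k-1}})`. -/
noncomputable def compoundDensity (c : X → Config X → ℝ≥0) {k : ℕ} (x : Fin k → X)
    (ω : Config X) : ℝ≥0 :=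
  ∏ i : Fin k, c (x i) (ω.addPoints fun j : {j : Fin k // j < i} => x j)

variable [MeasurableSpace X]

/-- The Campbell measure of the point process `P`, evaluated on measurable rectangles:
`C(A × B) = E[∫ 1_A(x) 1_B(ω \ {x}) ω(dx)]`. -/
noncomputable def campbell (P : Measure (Config X)) (A : Set X) (B : Set (Config X)) : ℝ≥0∞ :=
  ∫⁻ ω, ∫⁻ x, A.indicator 1 x * B.indicator 1 (ω.erase x) ∂ω.toMeasure ∂P

/-- `c` is a Papangelou density of the point process `P` with respect to `σ`:
it is measurable and `C(dx, dω) = c(x, ω) σ(dx) P(dω)`. Both sides are measures on the product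
that are determined by their values on measurable rectangles (the left one is finite on the
rectangles `U × {ω : ω(U) ≤ m}`, countably many of which cover `X × Config X`). -/
structure IsPapangelouDensity (σ : Measure X) (P : Measure (Config X))
    (c : X → Config X → ℝ≥0) : Prop where
  measurable : Measurable fun p : X × Config X => c p.1 p.2
  campbell_eq : ∀ (A : Set X) (B : Set (Config X)), MeasurableSet A → MeasurableSet B →
    campbell P A B = ∫⁻ p in A ×ˢ B, (c p.1 p.2 : ℝ≥0∞) ∂(σ.prod P)

/-- The random variable `ω ↦ ε⁺_{x}(u(x_1,·)^{b_1} ⋯ u(x_k,·)^{b_k})(ω) ĉ(x, ω)`. -/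
noncomputable def momentIntegrand (c : X → Config X → ℝ≥0) (u : X → Config X → ℝ) {k : ℕ}
    (b : Fin k → ℕ) (x : Fin k → X) (ω : Config X) : ℝ :=
  epsPlus x (fun η => ∏ i : Fin k, u (x i) η ^ b i) ω * (compoundDensity c x ω : ℝ)

end PointConfig

-- Expanding the `n`-th power of `∑_{x ∈ ω} u(x, ω)` gives a sum over `n`-tuples of points of `ω`.
-- Sorting the tuples by which of their coordinates coincide turns it into a sum over partitions `π`
-- of `{1, …, n}` and over tuples of distinct points, one per block, weighted by `∏ u(x_i,
-- ω)^{|B_i|}` (`tsum_indicator_pow`, `tsum_indicator_pow_real`).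
--
-- The expectation of a sum over `k`-tuples of distinct points is computed by the multivariate Mecke
-- formula `IsPapangelouDensity.lintegral_tsum_distinctTuples`. The Campbell identity, extended from
-- rectangles to nonnegative functions, replaces a summed point by a `σ`-integrated one with factor
-- `c`; iterating it `k` times produces `ĉ` and adds the points to `ω`.
--
-- For nonnegative functions no integrability is needed. Applied to `|u|`, the two facts bound `E[(∫
-- |u| dω)^n]` by the hypotheses, whence almost sure integrability of `u(·, ω)`. The signed identity
-- then follows by splitting each block weight, rather than `u`, into positive and negative parts.

universe u v

namespace PointConfig
namespace Config

/-! ### Configurations, their point measures, adding and removing points -/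

section Basic

variable {X : Type u} [TopologicalSpace X]

theorem isClosed_carrier [T1Space X] (ω : Config X) : IsClosed ω.carrier := by
  rw [← isOpen_compl_iff, isOpen_iff_mem_nhds]
  intro x hx
  obtain ⟨U, hU, hf⟩ := ω.locallyFinite x
  filter_upwards [hU, hf.isClosed.isOpen_compl.mem_nhds fun h => hx h.1] with y hyU hy hyω
  exact hy ⟨hyω, hyU⟩

@[simp]
theorem carrier_addPoints {ι : Type*} [Finite ι] (ω : Config X) (x : ι → X) :
    (ω.addPoints x).carrier = ω.carrier ∪ Set.range x := rfl

@[simp]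
theorem carrier_erase (ω : Config X) (x : X) : (ω.erase x).carrier = ω.carrier \ {x} := rfl

/-- `ω ∪ {x}`. -/
def insertPoint (ω : Config X) (x : X) : Config X := ω.addPoints fun _ : Unit => x

@[simp]
theorem carrier_insertPoint (ω : Config X) (x : X) :
    (ω.insertPoint x).carrier = insert x ω.carrier := by
  simp [insertPoint, Set.range_const]

theorem insertPoint_erase {ω : Config X} {x : X} (hx : x ∈ ω.carrier) :
    (ω.erase x).insertPoint x = ω := by
  ext y
  by_cases h : y = x <;> simp [h, hx]

theorem addPoints_zero (ω : Config X) (x : Fin 0 → X) : ω.addPoints x = ω := by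
  ext y
  simp

theorem addPoints_snoc {k : ℕ} (ω : Config X) (e : Fin k → X) (x : X) :
    ω.addPoints (Fin.snoc e x : Fin (k + 1) → X) = (ω.addPoints e).insertPoint x := by
  ext y
  simp only [carrier_addPoints, carrier_insertPoint, Set.mem_union, Set.mem_range,
    Set.mem_insert_iff, Fin.exists_fin_succ', Fin.snoc_castSucc, Fin.snoc_last]
  grind

variable [MeasurableSpace X]

/-- With measurable singletons, Dirac measures integrate arbitrary functions, so `f` need not be
measurable. Summing an indicator over all of `X` keeps the index type independent of `ω`. -/
theorem lintegral_toMeasure [MeasurableSingletonClass X] (ω : Config X) (f : X → ℝ≥0∞) :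
    ∫⁻ x, f x ∂ω.toMeasure = ∑' x, ω.carrier.indicator f x := by
  rw [toMeasure, lintegral_sum_measure]
  simp only [lintegral_dirac]
  exact tsum_subtype _ _

theorem toMeasure_apply [MeasurableSingletonClass X] (ω : Config X) {A : Set X}
    (hA : MeasurableSet A) :
    ω.toMeasure A = ∑' x, ω.carrier.indicator (A.indicator 1) x := by
  rw [← lintegral_toMeasure, lintegral_indicator_one hA]

theorem toMeasure_lt_top_of_finite [MeasurableSingletonClass X] (ω : Config X) {A : Set X}
    (hA : MeasurableSet A) (h : (ω.carrier ∩ A).Finite) : ω.toMeasure A < ∞ := by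
  rw [toMeasure_apply ω hA, Set.indicator_indicator, ← tsum_subtype]
  have := h.to_subtype
  have := Fintype.ofFinite ↑(ω.carrier ∩ A)
  rw [tsum_fintype]
  simp

theorem toMeasure_eq_zero_iff [MeasurableSingletonClass X] (ω : Config X) {A : Set X}
    (hA : MeasurableSet A) : ω.toMeasure A = 0 ↔ Disjoint ω.carrier A := by
  rw [toMeasure_apply ω hA, ENNReal.tsum_eq_zero, Set.disjoint_left]
  refine forall_congr' fun x => ?_
  by_cases h1 : x ∈ ω.carrier <;> by_cases h2 : x ∈ A <;> simp [h1, h2]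

theorem toMeasure_insertPoint [MeasurableSingletonClass X] (ω : Config X) (x : X) {A : Set X}
    (hA : MeasurableSet A) :
    (ω.insertPoint x).toMeasure A
      = ω.toMeasure A + ω.carrierᶜ.indicator (A.indicator 1) x := by
  classical
  have h : ω.carrierᶜ.indicator (A.indicator (1 : X → ℝ≥0∞)) x
      = ∑' y, ({x} : Set X).indicator (ω.carrierᶜ.indicator (A.indicator 1)) y := by
    rw [tsum_eq_single x fun y hy => by simp [hy]]
    simp
  rw [toMeasure_apply _ hA, toMeasure_apply _ hA, h, ← ENNReal.tsum_add]
  refine tsum_congr fun y => ?_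
  by_cases h1 : y ∈ ω.carrier <;> by_cases h2 : y = x <;> simp [h1, h2]

theorem toMeasure_erase_add [MeasurableSingletonClass X] (ω : Config X) (x : X) {A : Set X}
    (hA : MeasurableSet A) :
    (ω.erase x).toMeasure A + ω.carrier.indicator (A.indicator 1) x = ω.toMeasure A := by
  classical
  by_cases hx : x ∈ ω.carrier
  · conv_rhs => rw [← insertPoint_erase hx, toMeasure_insertPoint _ _ hA]
    simp [hx]
  · have : ω.erase x = ω := by
      ext y
      by_cases h : y = x <;> simp [h, hx]
    simp [this, hx]

theorem measurable_toMeasure_apply {A : Set X} (hA : MeasurableSet A) :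
    Measurable fun ω : Config X => ω.toMeasure A :=
  (Measure.measurable_coe hA).comp (comap_measurable _)

theorem measurable_of_toMeasure {T : Type*} [MeasurableSpace T] {g : T → Config X}
    (h : ∀ A, MeasurableSet A → Measurable fun t => (g t).toMeasure A) : Measurable g :=
  measurable_comap_iff.2 (Measure.measurable_of_measurable_coe _ h)

end Basic

/-! ### Joint measurability of membership, insertion, erasure and point sums -/

section Measurability

variable {X : Type u} [TopologicalSpace X] [PolishSpace X] [MeasurableSpace X] [BorelSpace X]

/-- Since `ω` is closed, `x ∈ ω` exactly when every basic open set around `x` is charged by `ω`;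
this is a countable intersection of conditions on counts. -/
theorem measurableSet_mem :
    MeasurableSet {p : Config X × X | p.2 ∈ p.1.carrier} := by
  let B := TopologicalSpace.countableBasis X
  have hB := TopologicalSpace.isBasis_countableBasis X
  have : {p : Config X × X | p.2 ∈ p.1.carrier}
      = ⋂ U ∈ B, {p : Config X × X | p.2 ∈ U → p.1.toMeasure U ≠ 0} := by
    ext ⟨ω, x⟩
    simp only [Set.mem_ofPred_eq, Set.mem_iInter]
    constructor
    · intro hx U hU hxU h0
      rw [toMeasure_eq_zero_iff _ (hB.isOpen hU).measurableSet] at h0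
      exact Set.disjoint_left.1 h0 hx hxU
    · intro h
      by_contra hx
      obtain ⟨U, hU, hxU, hUω⟩ :=
        hB.exists_subset_of_mem_open (u := ω.carrierᶜ) hx ω.isClosed_carrier.isOpen_compl
      refine h U hU hxU ((toMeasure_eq_zero_iff _ (hB.isOpen hU).measurableSet).2 ?_)
      exact (Set.subset_compl_iff_disjoint_left.1 hUω)
  rw [this]
  refine MeasurableSet.biInter (TopologicalSpace.countable_countableBasis X) fun U hU => ?_
  have hUm : MeasurableSet U := (hB.isOpen hU).measurableSet
  have h1 : MeasurableSet {p : Config X × X | p.2 ∈ U} := measurable_snd hUm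
  have h2 : MeasurableSet {p : Config X × X | p.1.toMeasure U ≠ 0} :=
    ((measurable_toMeasure_apply hUm).comp measurable_fst) (measurableSet_singleton 0).compl
  exact h1.imp h2

theorem measurable_insertPoint :
    Measurable fun p : Config X × X => p.1.insertPoint p.2 := by
  classical
  refine measurable_of_toMeasure fun A hA => ?_
  simp only [toMeasure_insertPoint _ _ hA]
  refine ((measurable_toMeasure_apply hA).comp measurable_fst).add ?_
  exact ((measurable_one.indicator hA).comp measurable_snd).indicator measurableSet_mem.compl

theorem measurable_erase : Measurable fun p : Config X × X => p.1.erase p.2 := by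
  classical
  refine measurable_of_toMeasure fun A hA => ?_
  have h : ∀ p : Config X × X, (p.1.erase p.2).toMeasure A
      = p.1.toMeasure A - p.1.carrier.indicator (A.indicator 1) p.2 := fun p => by
    refine ENNReal.eq_sub_of_add_eq ?_ (toMeasure_erase_add _ _ hA)
    by_cases h1 : p.2 ∈ p.1.carrier <;> by_cases h2 : p.2 ∈ A <;> simp [h1, h2]
  simp only [h]
  refine ((measurable_toMeasure_apply hA).comp measurable_fst).sub ?_
  exact ((measurable_one.indicator hA).comp measurable_snd).indicator measurableSet_mem

theorem measurable_addPoints (k : ℕ) :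
    Measurable fun p : Config X × (Fin k → X) => p.1.addPoints p.2 := by
  induction k with
  | zero => simpa only [addPoints_zero] using measurable_fst
  | succ k ih =>
    have h : ∀ p : Config X × (Fin (k + 1) → X), p.1.addPoints p.2
        = (p.1.addPoints (Fin.init p.2)).insertPoint (p.2 (Fin.last k)) := fun p => by
      rw [← addPoints_snoc, Fin.snoc_init_self]
    simp only [h]
    refine measurable_insertPoint.comp ((ih.comp (measurable_fst.prodMk ?_)).prodMk ?_)
    · exact measurable_pi_lambda _ fun i => (measurable_pi_apply _).comp measurable_snd
    · exact (measurable_pi_apply _).comp measurable_snd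

open ProbabilityTheory in
-- The generating maps only measure fixed sets, whereas here the set varies with the parameter.
-- Finite kernels allow varying sections, so `ω` is restricted to a finite union `V S` of basic open
-- sets and cut to zero unless it has at most `m` points there; the supremum over the countably many
-- pairs `(S, m)` recovers `ω`.
theorem measurable_toMeasure_section {T : Type v} [MeasurableSpace T] {t : Set ((T × Config X) × X)}
    (ht : MeasurableSet t) :
    Measurable fun p : T × Config X => p.2.toMeasure (Prod.mk p ⁻¹' t) := by
  classical
  let B := TopologicalSpace.countableBasis X
  have hB := TopologicalSpace.isBasis_countableBasis X
  have hBc : Countable B := (TopologicalSpace.countable_countableBasis X).to_subtype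
  let V : Finset B → Set X := fun S => ⋃ U ∈ S, (U : Set X)
  have hV : ∀ S, MeasurableSet (V S) := fun S =>
    Finset.measurableSet_biUnion _ fun U _ => (hB.isOpen U.2).measurableSet
  have hF : ∀ (S : Finset B) (m : ℕ),
      MeasurableSet {p : T × Config X | p.2.toMeasure (V S) ≤ m} := fun S m =>
    ((measurable_toMeasure_apply (hV S)).comp measurable_snd) measurableSet_Iic
  let κ : Finset B → ℕ → Kernel (T × Config X) X := fun S m =>
    ⟨fun p => if p ∈ {p : T × Config X | p.2.toMeasure (V S) ≤ m} then
        p.2.toMeasure.restrict (V S) else 0,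
      Measurable.ite (hF S m)
        (Measure.measurable_of_measurable_coe _ fun A hA => by
          simpa only [Measure.restrict_apply hA, Function.comp_def] using
            (measurable_toMeasure_apply (hA.inter (hV S))).comp measurable_snd)
        measurable_const⟩
  have hκ : ∀ S m, IsFiniteKernel (κ S m) := fun S m => by
    refine ⟨⟨m, by simp, fun p => ?_⟩⟩
    change (if p ∈ {p : T × Config X | p.2.toMeasure (V S) ≤ m} then
        p.2.toMeasure.restrict (V S) else 0 : Measure X) Set.univ ≤ m
    split_ifs with h
    · simpa using h
    · simp
  have key : ∀ p : T × Config X, p.2.toMeasure (Prod.mk p ⁻¹' t)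
      = ⨆ (S : Finset B) (m : ℕ), κ S m p (Prod.mk p ⁻¹' t) := fun p => by
    have hs : MeasurableSet (Prod.mk p ⁻¹' t) := measurable_prodMk_left ht
    apply le_antisymm
    -- Only basic sets with finitely many points of this configuration enter the exhaustion. Local
    -- finiteness makes them cover `X`, and each finite union of them passes the cutoff for some
    -- `m`.
    · let I := {U : B // p.2.toMeasure (U : Set X) < ∞}
      let j : I ↪ B := ⟨Subtype.val, Subtype.val_injective⟩
      have hcov : Prod.mk p ⁻¹' t = ⋃ S : Finset I, Prod.mk p ⁻¹' t ∩ V (S.map j) := by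
        rw [← Set.inter_iUnion, Set.left_eq_inter]
        intro x _
        obtain ⟨W, hW, hf⟩ := p.2.locallyFinite x
        obtain ⟨U, hU, hxU, hUW⟩ := hB.mem_nhds_iff.1 hW
        refine Set.mem_iUnion.2 ⟨{⟨⟨U, hU⟩, toMeasure_lt_top_of_finite _
          (hB.isOpen hU).measurableSet (hf.subset (Set.inter_subset_inter_right _ hUW))⟩}, ?_⟩
        simp only [V, Set.mem_iUnion]
        exact ⟨⟨U, hU⟩, by simp [j], hxU⟩
      conv_lhs => rw [hcov]
      rw [Directed.measure_iUnion]
      · refine iSup_le fun S => ?_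
        have hlt : p.2.toMeasure (V (S.map j)) < ∞ := by
          refine (measure_biUnion_finset_le _ _).trans_lt (ENNReal.sum_lt_top.2 fun U hU => ?_)
          obtain ⟨U', _, rfl⟩ := Finset.mem_map.1 hU
          exact U'.2
        obtain ⟨m, hm⟩ := ENNReal.exists_nat_gt hlt.ne
        refine le_iSup₂_of_le (S.map j) m ?_
        change _ ≤ (if p ∈ {p : T × Config X | p.2.toMeasure (V _) ≤ m} then
          p.2.toMeasure.restrict (V _) else 0 : Measure X) _
        have hp : p ∈ {p : T × Config X | p.2.toMeasure (V (S.map j)) ≤ m} := hm.le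
        rw [if_pos hp, Measure.restrict_apply hs]
      · refine Monotone.directed_le fun S S' h => Set.inter_subset_inter_right _ ?_
        exact Set.biUnion_subset_biUnion_left (Finset.map_subset_map.2 h)
    · refine iSup₂_le fun S m => ?_
      change (if p ∈ {p : T × Config X | p.2.toMeasure (V S) ≤ m} then
        p.2.toMeasure.restrict (V S) else 0 : Measure X) _ ≤ _
      split_ifs
      · exact Measure.restrict_apply_le _ _
      · simp
  simp only [key]
  exact .iSup fun S => .iSup fun m => Kernel.measurable_kernel_prodMk_left ht

theorem measurable_map_toMeasure {T : Type v} [MeasurableSpace T] :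
    Measurable fun p : T × Config X => p.2.toMeasure.map (Prod.mk p) := by
  refine Measure.measurable_of_measurable_coe _ fun t ht => ?_
  simpa only [Measure.map_apply measurable_prodMk_left ht] using measurable_toMeasure_section ht

theorem measurable_lintegral_toMeasure {T : Type v} [MeasurableSpace T]
    {f : (T × Config X) × X → ℝ≥0∞} (hf : Measurable f) :
    Measurable fun p : T × Config X => ∫⁻ x, f (p, x) ∂p.2.toMeasure := by
  have := (Measure.measurable_lintegral hf).comp (measurable_map_toMeasure (X := X) (T := T))
  simpa only [Function.comp_def, lintegral_map hf measurable_prodMk_left] using this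

end Measurability

end Config
-- The Campbell identity for nonnegative functions
section Papangelou

variable {X : Type u} [TopologicalSpace X] [PolishSpace X] [MeasurableSpace X] [BorelSpace X]

namespace Config

theorem measurable_map_toMeasure_of_measurable {Y : Type*} [MeasurableSpace Y]
    {g : Config X × X → Y} (hg : Measurable g) :
    Measurable fun ω : Config X => ω.toMeasure.map fun x => g (ω, x) := by
  refine Measure.measurable_of_measurable_coe _ fun s hs => ?_
  have h := (measurable_toMeasure_section (T := Unit) (X := X)
    (t := (fun p : (Unit × Config X) × X => g (p.1.2, p.2)) ⁻¹' s)
    ((hg.comp (by fun_prop)) hs)).comp (measurable_prodMk_left (x := ()))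
  have hgω : ∀ ω : Config X, Measurable fun x => g (ω, x) := fun ω =>
    hg.comp measurable_prodMk_left
  simp only [Measure.map_apply (hgω _) hs]
  exact h

theorem measurable_lintegral_toMeasure_of_measurable {f : Config X × X → ℝ≥0∞}
    (hf : Measurable f) : Measurable fun ω : Config X => ∫⁻ x, f (ω, x) ∂ω.toMeasure := by
  have := (Measure.measurable_lintegral hf).comp
    (measurable_map_toMeasure_of_measurable (X := X) measurable_id)
  simpa only [Function.comp_def, id, lintegral_map hf measurable_prodMk_left] using this

end Config

/-- Erasing one point lowers the count in `U` by at most one, so a nonzero contribution forces `ω(U)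
≤ m + 1`, and then the inner integral is at most `m + 1`. -/
theorem campbell_rectangle_lt_top (P : Measure (Config X)) [IsProbabilityMeasure P] {U : Set X}
    (hU : MeasurableSet U) (m : ℕ) : campbell P U {ω | ω.toMeasure U ≤ m} < ∞ := by
  refine (lintegral_mono (g := fun _ => ((m + 1 : ℕ) : ℝ≥0∞)) fun ω => ?_).trans_lt (by simp)
  by_cases hω : ω.toMeasure U ≤ (m + 1 : ℕ)
  · refine (lintegral_mono (g := U.indicator 1) fun x => ?_).trans ?_
    · refine mul_le_of_le_one_right' ?_
      exact Set.indicator_le_self' (fun _ _ => zero_le) _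
    · rwa [lintegral_indicator_one hU]
  · rw [Config.lintegral_toMeasure]
    refine le_of_eq_of_le (ENNReal.tsum_eq_zero.2 fun x => ?_) zero_le
    by_cases hx : x ∈ ω.carrier
    · by_cases hxU : x ∈ U
      · have h := Config.toMeasure_erase_add ω x hU
        have h' : ¬ (ω.erase x).toMeasure U ≤ m := fun h'' => hω <| by
          rw [← h]
          simpa [hx, hxU] using h''
        simp [hx, h']
      · simp [hxU]
    · simp [hx]

/-- Both sides are integrals of `f` against measures agreeing on the π-system of measurable
rectangles. Countably many rectangles of finite Campbell mass cover the product, so the measures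
coincide. -/
theorem IsPapangelouDensity.lintegral_eq {σ : Measure X} [SigmaFinite σ] {P : Measure (Config X)}
    [IsProbabilityMeasure P] {c : X → Config X → ℝ≥0} (hc : IsPapangelouDensity σ P c)
    {f : X × Config X → ℝ≥0∞} (hf : Measurable f) :
    ∫⁻ ω, ∫⁻ x, f (x, ω.erase x) ∂ω.toMeasure ∂P
      = ∫⁻ p, f p * c p.1 p.2 ∂(σ.prod P) := by
  have hcm : Measurable fun p : X × Config X => (c p.1 p.2 : ℝ≥0∞) :=
    measurable_coe_nnreal_ennreal.comp hc.measurable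
  have hg : Measurable fun p : Config X × X => (p.2, p.1.erase p.2) :=
    measurable_snd.prodMk Config.measurable_erase
  have hκ := Config.measurable_map_toMeasure_of_measurable hg
  set M : Measure (X × Config X) := P.bind fun ω => ω.toMeasure.map fun x => (x, ω.erase x)
  have hM : ∀ {f : X × Config X → ℝ≥0∞}, Measurable f →
      ∫⁻ p, f p ∂M = ∫⁻ ω, ∫⁻ x, f (x, ω.erase x) ∂ω.toMeasure ∂P := fun {f} hf => by
    rw [Measure.lintegral_bind hκ.aemeasurable hf.aemeasurable]
    refine lintegral_congr fun ω => ?_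
    exact lintegral_map hf (hg.comp measurable_prodMk_left)
  have hMr : ∀ {A : Set X} {B : Set (Config X)}, MeasurableSet A → MeasurableSet B →
      M (A ×ˢ B) = campbell P A B := fun {A B} hA hB => by
    rw [← lintegral_indicator_one (hA.prod hB), hM (measurable_one.indicator (hA.prod hB))]
    refine lintegral_congr fun ω => lintegral_congr fun x => ?_
    by_cases h1 : x ∈ A <;> by_cases h2 : ω.erase x ∈ B <;> simp [h1, h2]
  have key : M = (σ.prod P).withDensity fun p => (c p.1 p.2 : ℝ≥0∞) := by
    let B := TopologicalSpace.countableBasis X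
    have hB := TopologicalSpace.isBasis_countableBasis X
    have hBc : Countable B := (TopologicalSpace.countable_countableBasis X).to_subtype
    have hBm : ∀ U : B, MeasurableSet (U : Set X) := fun U => (hB.isOpen U.2).measurableSet
    let R : B × ℕ → Set (X × Config X) := fun q =>
      (q.1 : Set X) ×ˢ {ω | ω.toMeasure (q.1 : Set X) ≤ (q.2 : ℝ≥0∞)}
    have hR : ∀ q : B × ℕ, MeasurableSet {ω : Config X | ω.toMeasure q.1 ≤ q.2} := fun q =>
      Config.measurable_toMeasure_apply (hBm q.1) measurableSet_Iic
    refine Measure.ext_of_generateFrom_of_cover_subset generateFrom_prod.symm isPiSystem_prod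
      (T := Set.range R) ?_ (Set.countable_range R) ?_ ?_ ?_
    · rintro _ ⟨q, rfl⟩
      exact ⟨_, hBm q.1, _, hR q, rfl⟩
    · refine Set.eq_univ_of_forall fun ⟨x, ω⟩ => ?_
      obtain ⟨W, hW, hfin⟩ := ω.locallyFinite x
      obtain ⟨U, hU, hxU, hUW⟩ := hB.mem_nhds_iff.1 hW
      obtain ⟨m, hm⟩ := ENNReal.exists_nat_gt (ω.toMeasure_lt_top_of_finite
        (hBm ⟨U, hU⟩) (hfin.subset (Set.inter_subset_inter_right _ hUW))).ne
      exact ⟨_, ⟨(⟨U, hU⟩, m), rfl⟩, hxU, hm.le⟩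
    · rintro _ ⟨q, rfl⟩
      rw [hMr (hBm q.1) (hR q)]
      exact (campbell_rectangle_lt_top P (hBm q.1) q.2).ne
    · rintro _ ⟨A, hA, D, hD, rfl⟩
      change MeasurableSet A at hA
      change MeasurableSet D at hD
      rw [hMr hA hD, hc.campbell_eq A D hA hD, withDensity_apply _ (hA.prod hD)]
  rw [← hM hf, key, lintegral_withDensity_eq_lintegral_mul _ hcm hf]
  simp only [Pi.mul_apply, mul_comm]

end Papangelou

/-! ### Splitting off the last coordinate of a tuple -/

section Snoc

variable {X : Type u} [MeasurableSpace X]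

theorem measurable_snoc {k : ℕ} :
    Measurable fun p : (Fin k → X) × X => (Fin.snoc p.1 p.2 : Fin (k + 1) → X) := by
  refine measurable_pi_lambda _ fun i => ?_
  induction i using Fin.lastCases with
  | last => simpa only [Fin.snoc_last] using measurable_snd
  | cast i => simpa only [Fin.snoc_castSucc, Function.comp_def] using
      (measurable_pi_apply i).comp measurable_fst

theorem lintegral_pi_succ (σ : Measure X) [SigmaFinite σ] {k : ℕ} {g : (Fin (k + 1) → X) → ℝ≥0∞}
    (hg : Measurable g) :
    ∫⁻ x, g x ∂(Measure.pi fun _ => σ)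
      = ∫⁻ y, ∫⁻ e : Fin k → X, g (Fin.snoc e y) ∂(Measure.pi fun _ => σ) ∂σ := by
  have hs : Measurable fun p : X × (Fin k → X) => g (Fin.snoc p.2 p.1) :=
    hg.comp (measurable_snoc.comp measurable_swap)
  have h := (measurePreserving_piFinSuccAbove (fun _ : Fin (k + 1) => σ)
    (Fin.last k)).lintegral_comp hs
  rw [← lintegral_prod _ hs.aemeasurable, ← h]
  refine lintegral_congr fun x => ?_
  congr 1
  exact (Fin.snoc_init_self x).symm.trans (by simp [MeasurableEquiv.piFinSuccAbove, Fin.init_def])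

end Snoc

/-! ### Sums over tuples of distinct points and the multivariate Mecke formula -/

section Factorial

variable {X : Type u} [TopologicalSpace X]

/-- The `k`-tuples of distinct points of a configuration. -/
def distinctTuples (k : ℕ) (ω : Config X) : Set (Fin k → X) :=
  {x | Function.Injective x ∧ ∀ i, x i ∈ ω.carrier}

theorem snoc_mem_distinctTuples {k : ℕ} {ω : Config X} {e : Fin k → X} {y : X} :
    (Fin.snoc e y : Fin (k + 1) → X) ∈ distinctTuples (k + 1) ω
      ↔ y ∈ ω.carrier ∧ e ∈ distinctTuples k (ω.erase y) := by
  simp only [distinctTuples, Set.mem_ofPred_eq, Fin.snoc_injective_iff, Fin.forall_fin_succ',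
    Fin.snoc_castSucc, Fin.snoc_last, Config.carrier_erase, Set.mem_sdiff, Set.mem_range,
    Set.mem_singleton_iff, not_exists, forall_and]
  tauto

theorem tsum_distinctTuples_zero (ω : Config X) (g : (Fin 0 → X) → ℝ≥0∞) :
    ∑' x, (distinctTuples 0 ω).indicator g x = g Fin.elim0 := by
  have h : (Fin.elim0 : Fin 0 → X) ∈ distinctTuples 0 ω :=
    ⟨fun i => i.elim0, fun i => i.elim0⟩
  rw [tsum_eq_single Fin.elim0 fun x hx => (hx (Subsingleton.elim _ _)).elim,
    Set.indicator_of_mem h]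

/-- The last factor sees all earlier points and the others never see the last one. Hence the
induction peels off the last coordinate. -/
theorem compoundDensity_snoc (c : X → Config X → ℝ≥0) {k : ℕ} (e : Fin k → X) (y : X)
    (ω : Config X) :
    compoundDensity c (Fin.snoc e y : Fin (k + 1) → X) ω
      = compoundDensity c e ω * c y (ω.addPoints e) := by
  rw [compoundDensity, Fin.prod_univ_castSucc, compoundDensity]
  congr 1
  · refine Finset.prod_congr rfl fun i _ => ?_
    rw [Fin.snoc_castSucc]
    congr 1
    ext z
    simp only [Config.carrier_addPoints, Set.mem_union, Set.mem_range, Subtype.exists]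
    refine or_congr_right ⟨?_, ?_⟩
    · rintro ⟨j, hj, rfl⟩
      refine ⟨j.castLT (hj.trans_le (Fin.le_last _)), hj, ?_⟩
      conv_rhs => rw [← Fin.castSucc_castLT j (hj.trans_le (Fin.le_last _)), Fin.snoc_castSucc]
    · rintro ⟨j, hj, rfl⟩
      exact ⟨j.castSucc, hj, Fin.snoc_castSucc ..⟩
  · rw [Fin.snoc_last]
    congr 1
    ext z
    simp only [Config.carrier_addPoints, Set.mem_union, Set.mem_range, Subtype.exists]
    refine or_congr_right ⟨?_, ?_⟩
    · rintro ⟨j, hj, rfl⟩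
      refine ⟨j.castLT hj, ?_⟩
      conv_rhs => rw [← Fin.castSucc_castLT j hj, Fin.snoc_castSucc]
    · rintro ⟨j, rfl⟩
      exact ⟨j.castSucc, Fin.castSucc_lt_last j, Fin.snoc_castSucc ..⟩

variable [MeasurableSpace X]

theorem tsum_distinctTuples_succ [MeasurableSingletonClass X] {k : ℕ} (ω : Config X)
    (g : (Fin (k + 1) → X) → ℝ≥0∞) :
    ∑' x, (distinctTuples (k + 1) ω).indicator g x
      = ∫⁻ y, ∑' e : Fin k → X, (distinctTuples k (ω.erase y)).indicator
          (fun e => g (Fin.snoc e y)) e ∂ω.toMeasure := by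
  classical
  rw [Config.lintegral_toMeasure, ← (Fin.snocEquiv fun _ => X).tsum_eq, ENNReal.tsum_prod']
  refine tsum_congr fun y => ?_
  by_cases hy : y ∈ ω.carrier
  · rw [Set.indicator_of_mem hy]
    refine tsum_congr fun e => ?_
    change (distinctTuples (k + 1) ω).indicator g (Fin.snoc e y) = _
    simp [Set.indicator_apply, snoc_mem_distinctTuples, hy]
  · rw [Set.indicator_of_notMem hy, ENNReal.tsum_eq_zero]
    intro e
    change (distinctTuples (k + 1) ω).indicator g (Fin.snoc e y) = _
    simp [snoc_mem_distinctTuples, hy]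

variable [PolishSpace X] [BorelSpace X]

theorem measurable_compoundDensity {c : X → Config X → ℝ≥0}
    (hc : Measurable fun p : X × Config X => c p.1 p.2) (k : ℕ) :
    Measurable fun p : Config X × (Fin k → X) => compoundDensity c p.2 p.1 := by
  induction k with
  | zero => simp [compoundDensity]
  | succ k ih =>
    have h : ∀ p : Config X × (Fin (k + 1) → X), compoundDensity c p.2 p.1
        = compoundDensity c (Fin.init p.2) p.1
          * c (p.2 (Fin.last k)) (p.1.addPoints (Fin.init p.2)) := fun p => by
      rw [← compoundDensity_snoc, Fin.snoc_init_self]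
    simp only [h]
    have hinit : Measurable fun p : Config X × (Fin (k + 1) → X) => (p.1, Fin.init p.2) :=
      measurable_fst.prodMk
        (measurable_pi_lambda _ fun i => (measurable_pi_apply _).comp measurable_snd)
    exact (ih.comp hinit).mul (hc.comp (((measurable_pi_apply _).comp measurable_snd).prodMk
      ((Config.measurable_addPoints k).comp hinit)))

/-- The parameter space `T` is what makes the induction on `k` work: the point split off the tuple,
together with the original configuration, becomes part of the parameter while the configuration is
replaced by `ω \ {y}`. -/
theorem measurable_tsum_distinctTuples (k : ℕ) {T : Type u} [MeasurableSpace T]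
    {f : (T × Config X) × (Fin k → X) → ℝ≥0∞} (hf : Measurable f) :
    Measurable fun p : T × Config X =>
      ∑' x, (distinctTuples k p.2).indicator (fun x => f (p, x)) x := by
  induction k generalizing T with
  | zero =>
    have h : ∀ p : T × Config X, ∑' x, (distinctTuples 0 p.2).indicator (fun x => f (p, x)) x
        = f (p, Fin.elim0) := fun p => tsum_distinctTuples_zero _ _
    simp only [h]
    exact hf.comp measurable_prodMk_right
  | succ k ih =>
    simp only [tsum_distinctTuples_succ]
    have h := ih (T := (T × Config X) × X)
      (f := fun q => f (q.1.1.1, Fin.snoc q.2 q.1.1.2))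
      (hf.comp (((measurable_fst.comp measurable_fst).comp measurable_fst).prodMk
        (measurable_snoc.comp
          (measurable_snd.prodMk ((measurable_snd.comp measurable_fst).comp measurable_fst)))))
    refine Config.measurable_lintegral_toMeasure (f := fun q : (T × Config X) × X =>
      ∑' e, (distinctTuples k (q.1.2.erase q.2)).indicator (fun e => f (q.1, Fin.snoc e q.2)) e) ?_
    exact h.comp (measurable_id.prodMk (Config.measurable_erase.comp
      ((measurable_snd.comp measurable_fst).prodMk measurable_snd)))

theorem measurable_tsum_distinctTuples' {k : ℕ} {f : Config X × (Fin k → X) → ℝ≥0∞}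
    (hf : Measurable f) :
    Measurable fun ω : Config X =>
      ∑' x, (distinctTuples k ω).indicator (fun x => f (ω, x)) x :=
  (measurable_tsum_distinctTuples k (T := PUnit.{u + 1})
    (hf.comp ((measurable_snd.comp measurable_fst).prodMk measurable_snd))).comp
    (measurable_prodMk_left (x := PUnit.unit))

/-- The multivariate Mecke (Georgii–Nguyen–Zessin) formula. -/
theorem IsPapangelouDensity.lintegral_tsum_distinctTuples {σ : Measure X} [SigmaFinite σ]
    {P : Measure (Config X)} [IsProbabilityMeasure P] {c : X → Config X → ℝ≥0}
    (hc : IsPapangelouDensity σ P c) (k : ℕ) {f : Config X × (Fin k → X) → ℝ≥0∞}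
    (hf : Measurable f) :
    ∫⁻ ω, ∑' x, (distinctTuples k ω).indicator (fun x => f (ω, x)) x ∂P
      = ∫⁻ p, f (p.1.addPoints p.2, p.2) * compoundDensity c p.2 p.1
          ∂(P.prod (Measure.pi fun _ : Fin k => σ)) := by
  have hD : ∀ k, Measurable fun p : Config X × (Fin k → X) => (compoundDensity c p.2 p.1 : ℝ≥0∞) :=
    fun k => measurable_coe_nnreal_ennreal.comp (measurable_compoundDensity hc.measurable k)
  have hcm : Measurable fun p : X × Config X => (c p.1 p.2 : ℝ≥0∞) :=
    measurable_coe_nnreal_ennreal.comp hc.measurable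
  have hI : ∀ k (f : Config X × (Fin k → X) → ℝ≥0∞), Measurable f →
      Measurable fun p : Config X × (Fin k → X) =>
        f (p.1.addPoints p.2, p.2) * compoundDensity c p.2 p.1 := fun k f hf =>
    (hf.comp ((Config.measurable_addPoints k).prodMk measurable_snd)).mul (hD k)
  induction k with
  | zero =>
    rw [lintegral_prod _ (hI 0 f hf).aemeasurable]
    refine lintegral_congr fun ω => ?_
    rw [Measure.pi_of_empty _ Fin.elim0, lintegral_dirac,
      tsum_distinctTuples_zero]
    simp [compoundDensity, Config.addPoints_zero]
  | succ k ih =>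
    have hh : Measurable fun q : (X × Config X) × (Fin k → X) =>
        f (q.1.2.insertPoint q.1.1, Fin.snoc q.2 q.1.1) := by
      refine hf.comp (Measurable.prodMk ?_ ?_)
      · exact Config.measurable_insertPoint.comp (measurable_swap.comp measurable_fst)
      · exact measurable_snoc.comp (measurable_snd.prodMk (measurable_fst.comp measurable_fst))
    have hG : Measurable fun q : X × Config X =>
        ∑' e, (distinctTuples k q.2).indicator
          (fun e => f (q.2.insertPoint q.1, Fin.snoc e q.1)) e :=
      measurable_tsum_distinctTuples k hh
    have hH : Measurable fun q : (X × Config X) × (Fin k → X) =>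
        f (q.1.2.addPoints (Fin.snoc q.2 q.1.1 : Fin (k + 1) → X), Fin.snoc q.2 q.1.1) *
          compoundDensity c (Fin.snoc q.2 q.1.1 : Fin (k + 1) → X) q.1.2 :=
      (hI (k + 1) f hf).comp ((measurable_snd.comp measurable_fst).prodMk
        (measurable_snoc.comp (measurable_snd.prodMk (measurable_fst.comp measurable_fst))))
    -- Writing `ω = (ω \ {y}) ∪ {y}` puts the summand in the form required by the Campbell identity.
    -- The factor `c(y, ω)` is then absorbed into the function for the induction hypothesis, which
    -- evaluates it at `ω ∪ e`: exactly the last factor of `ĉ`.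
    calc ∫⁻ ω, ∑' x, (distinctTuples (k + 1) ω).indicator (fun x => f (ω, x)) x ∂P
        = ∫⁻ ω, ∫⁻ y, (∑' e, (distinctTuples k (ω.erase y)).indicator
            (fun e => f ((ω.erase y).insertPoint y, Fin.snoc e y)) e) ∂ω.toMeasure ∂P := by
          refine lintegral_congr fun ω => ?_
          rw [tsum_distinctTuples_succ, Config.lintegral_toMeasure, Config.lintegral_toMeasure]
          refine tsum_congr fun y => ?_
          by_cases hy : y ∈ ω.carrier
          · simp only [Set.indicator_of_mem hy, Config.insertPoint_erase hy]
          · simp only [Set.indicator_of_notMem hy]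
      _ = ∫⁻ p, (∑' e, (distinctTuples k p.2).indicator
            (fun e => f (p.2.insertPoint p.1, Fin.snoc e p.1)) e) * c p.1 p.2 ∂(σ.prod P) :=
          hc.lintegral_eq hG
      _ = ∫⁻ y, ∫⁻ ω, ∑' e, (distinctTuples k ω).indicator
            (fun e => f (ω.insertPoint y, Fin.snoc e y) * c y ω) e ∂P ∂σ := by
          refine (lintegral_prod _ (hG.mul hcm).aemeasurable).trans ?_
          refine lintegral_congr fun y => lintegral_congr fun ω => ?_
          simp only [Pi.mul_apply]
          rw [← ENNReal.tsum_mul_right]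
          refine tsum_congr fun e => ?_
          rw [Set.indicator_mul_left]
      _ = ∫⁻ y, ∫⁻ ω, ∫⁻ e : Fin k → X,
            f (ω.addPoints (Fin.snoc e y : Fin (k + 1) → X), Fin.snoc e y) *
              compoundDensity c (Fin.snoc e y : Fin (k + 1) → X) ω
            ∂(Measure.pi fun _ => σ) ∂P ∂σ := by
          refine lintegral_congr fun y => ?_
          have hfy : Measurable fun p : Config X × (Fin k → X) =>
              f (p.1.insertPoint y, Fin.snoc p.2 y) * c y p.1 :=
            (hh.comp ((measurable_const.prodMk measurable_fst).prodMk measurable_snd)).mul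
              (hcm.comp (measurable_const.prodMk measurable_fst))
          rw [ih hfy, lintegral_prod _ (hI k _ hfy).aemeasurable]
          refine lintegral_congr fun ω => lintegral_congr fun e => ?_
          rw [Config.addPoints_snoc, compoundDensity_snoc, ENNReal.coe_mul]
          ring
      _ = _ := by
          rw [lintegral_lintegral_swap hH.lintegral_prod_right'.aemeasurable,
            lintegral_prod _ (hI (k + 1) f hf).aemeasurable]
          refine lintegral_congr fun ω => ?_
          exact (lintegral_pi_succ σ ((hI (k + 1) f hf).comp measurable_prodMk_left)).symm

end Factorial
-- Powers of sums as sums over partitions with distinctly labelled blocks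
section Partitions

open Function

/-- Partitions of `Fin n` whose blocks are labelled by distinct elements of `Y`. -/
abbrev LabelledPartition (Y : Type*) (n : ℕ) :=
  Σ π : OrderedFinpartition n, {x : Fin π.length → Y // Injective x}

variable {Y : Type*} {n : ℕ}

/-- The weight `∏ v(x_i)^{b_i}` of a labelled partition. -/
def LabelledPartition.weight {R : Type*} [CommMonoid R] (v : Y → R) (p : LabelledPartition Y n) :
    R :=
  ∏ i, v (p.2.1 i) ^ p.1.partSize i

/-- The labelling of the restriction of a partition of `Fin (n + 1)`, with the label of the block
of the removed element. -/
def restrictLabels (c : OrderedFinpartition n) :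
    (Σ o : Option (Fin c.length), {x : Fin (c.extend o).length → Y // Injective x}) →
      {x : Fin c.length → Y // Injective x} × Y
  | ⟨none, x⟩ =>
    (⟨fun i => x.1 (Fin.succ i : Fin (c.length + 1)), fun _ _ h => Fin.succ_injective _ (x.2 h)⟩,
      x.1 (0 : Fin (c.length + 1)))
  | ⟨some i, x⟩ => (x, x.1 i)

/-- A further label `y` either equals the label of exactly one block, which the new element joins,
or is new and opens a singleton block. Injectivity of the labels excludes any overlap. -/
theorem restrictLabels_bijective (c : OrderedFinpartition n) :
    Bijective (restrictLabels (Y := Y) c) := by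
  constructor
  · rintro ⟨_ | i, x⟩ ⟨_ | j, y⟩ h
    · obtain ⟨h1, h2⟩ := Prod.ext_iff.1 h
      have : x = y := by
        refine Subtype.ext (funext fun l => ?_)
        change Fin (c.length + 1) at l
        induction l using Fin.cases with
        | zero => exact h2
        | succ l => exact congrFun (Subtype.ext_iff.1 h1) l
      rw [this]
    · obtain ⟨h1, h2⟩ := Prod.ext_iff.1 h
      have h3 : x.1 (Fin.succ j : Fin (c.length + 1)) = y.1 j := congrFun (Subtype.ext_iff.1 h1) j
      exact absurd (x.2 (h3.trans h2.symm)) (Fin.succ_ne_zero j)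
    · obtain ⟨h1, h2⟩ := Prod.ext_iff.1 h
      have h3 : x.1 i = y.1 (Fin.succ i : Fin (c.length + 1)) := congrFun (Subtype.ext_iff.1 h1) i
      exact absurd (y.2 (h3.symm.trans h2)) (Fin.succ_ne_zero i)
    · obtain ⟨h1, h2⟩ := Prod.ext_iff.1 h
      have h3 : x = y := h1
      subst h3
      have : i = j := x.2 h2
      rw [this]
  · rintro ⟨x, y⟩
    by_cases h : ∃ i, x.1 i = y
    · obtain ⟨i, rfl⟩ := h
      exact ⟨⟨some i, x⟩, rfl⟩
    · refine ⟨⟨none, ⟨(Fin.cons y x.1 : Fin (c.length + 1) → Y),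
        Fin.cons_injective_iff.2 ⟨fun ⟨i, hi⟩ => h ⟨i, hi⟩, x.2⟩⟩⟩, rfl⟩

theorem prod_pow_update {R ι : Type*} [CommMonoid R] [Fintype ι] [DecidableEq ι] (f : ι → R)
    (b : ι → ℕ) (i : ι) :
    ∏ j, f j ^ update b i (b i + 1) j = (∏ j, f j ^ b j) * f i := by
  rw [← Finset.mul_prod_erase _ (fun j => f j ^ update b i (b i + 1) j) (Finset.mem_univ i),
    ← Finset.mul_prod_erase _ (fun j => f j ^ b j) (Finset.mem_univ i),
    update_self, pow_succ, mul_right_comm]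
  congr 2
  refine Finset.prod_congr rfl fun j hj => ?_
  rw [update_of_ne (Finset.ne_of_mem_erase hj)]

theorem weight_extend {R : Type*} [CommMonoid R] (v : Y → R) (c : OrderedFinpartition n)
    (q : Σ o : Option (Fin c.length), {x : Fin (c.extend o).length → Y // Injective x}) :
    LabelledPartition.weight v ⟨c.extend q.1, q.2⟩
      = LabelledPartition.weight v ⟨c, (restrictLabels c q).1⟩ * v (restrictLabels c q).2 := by
  classical
  obtain ⟨_ | i, x⟩ := q
  · change ∏ i : Fin (c.length + 1), v (x.1 i) ^ (Fin.cons 1 c.partSize : Fin _ → ℕ) i = _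
    rw [Fin.prod_univ_succ, mul_comm]
    simp only [Fin.cons_zero, Fin.cons_succ, pow_one]
    rfl
  · change ∏ j : Fin c.length, v (x.1 j) ^ update c.partSize i (c.partSize i + 1) j
      = (∏ j : Fin c.length, v (x.1 j) ^ c.partSize j) * v (x.1 i)
    exact prod_pow_update (fun j => v (x.1 j)) c.partSize i

/-- A labelled partition of `Fin (n + 1)` is a labelled partition of `Fin n` together with the
label of the block of the additional element. -/
noncomputable def labelledPartitionSuccEquiv (Y : Type*) (n : ℕ) :
    LabelledPartition Y (n + 1) ≃ LabelledPartition Y n × Y :=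
  (((Equiv.sigmaAssoc fun (c : OrderedFinpartition n) (o : Option (Fin c.length)) =>
      {x : Fin (c.extend o).length → Y // Injective x}).symm.trans
    (Equiv.sigmaCongrLeft (β := fun π : OrderedFinpartition (n + 1) =>
      {x : Fin π.length → Y // Injective x}) (OrderedFinpartition.extendEquiv n))).symm.trans
    (Equiv.sigmaCongrRight fun c => Equiv.ofBijective _ (restrictLabels_bijective c))).trans
    (Equiv.sigmaProdDistrib _ _).symm

theorem weight_labelledPartitionSuccEquiv_symm {R : Type*} [CommMonoid R] (v : Y → R)
    (q : LabelledPartition Y n × Y) :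
    LabelledPartition.weight v ((labelledPartitionSuccEquiv Y n).symm q)
      = LabelledPartition.weight v q.1 * v q.2 := by
  obtain ⟨⟨c, x⟩, y⟩ := q
  -- Naming a preimage `q` lets the inverse of the noncomputable bijection be evaluated.
  obtain ⟨q, hq⟩ := (restrictLabels_bijective c).2 (x, y)
  have : (labelledPartitionSuccEquiv Y n).symm (⟨c, x⟩, y) = ⟨c.extend q.1, q.2⟩ := by
    have h : (labelledPartitionSuccEquiv Y n).symm
        (⟨c, (restrictLabels c q).1⟩, (restrictLabels c q).2) = ⟨c.extend q.1, q.2⟩ := by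
      have h' : (Equiv.ofBijective _ (restrictLabels_bijective c)).symm
          ((restrictLabels c q).1, (restrictLabels c q).2) = q :=
        (Equiv.symm_apply_eq _).2 rfl
      exact congrArg (fun q' : Σ o : Option (Fin c.length),
        {x : Fin (c.extend o).length → Y // Injective x} =>
          (⟨c.extend q'.1, q'.2⟩ : LabelledPartition Y (n + 1))) h'
    rw [hq] at h
    exact h
  rw [this, weight_extend, hq]

instance : Unique (LabelledPartition Y 0) where
  default := ⟨OrderedFinpartition.atomic 0, ⟨Fin.elim0, fun i => i.elim0⟩⟩
  uniq := by
    rintro ⟨π, x⟩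
    obtain rfl : π = OrderedFinpartition.atomic 0 := Subsingleton.elim _ _
    congr
    exact Subtype.ext (funext fun i => Fin.elim0 i)

theorem weight_zero {R : Type*} [CommMonoid R] (v : Y → R) (p : LabelledPartition Y 0) :
    p.weight v = 1 := by
  obtain rfl : p = default := Subsingleton.elim _ _
  exact Finset.prod_of_isEmpty (ι := Fin 0) _

/-- Labelled partitions encode maps `Fin n → Y` by their fibres; multiplying by one more sum appends
one value to the map. -/
theorem tsum_pow_eq_tsum_weight (v : Y → ℝ≥0∞) (n : ℕ) :
    (∑' y, v y) ^ n = ∑' p : LabelledPartition Y n, p.weight v := by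
  induction n with
  | zero => simp [weight_zero]
  | succ n ih =>
    rw [← (labelledPartitionSuccEquiv Y n).symm.tsum_eq, ENNReal.tsum_prod']
    simp only [weight_labelledPartitionSuccEquiv_symm, ENNReal.tsum_mul_left,
      ENNReal.tsum_mul_right]
    rw [← ih, pow_succ]

theorem hasSum_weight_pow {v : Y → ℝ} (hv : Summable v) (n : ℕ) :
    HasSum (fun p : LabelledPartition Y n => p.weight v) ((∑' y, v y) ^ n) := by
  induction n with
  | zero => simp [weight_zero]
  | succ n ih =>
    rw [← (labelledPartitionSuccEquiv Y n).symm.hasSum_iff, pow_succ]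
    have := ih.mul hv.hasSum
      (summable_mul_of_summable_norm ih.summable.norm hv.norm)
    simpa only [Function.comp_def, weight_labelledPartitionSuccEquiv_symm] using this

end Partitions

/-! ### Power expansion over the points of one configuration -/

section Moments

variable {X : Type u} [TopologicalSpace X]

/-- Blocks are non-empty, so every exponent is positive and a coordinate outside `ω` kills the
product. -/
theorem indicator_weight {R : Type*} [CommSemiring R] (ω : Config X) (v : X → R) {n : ℕ}
    (π : OrderedFinpartition n) (x : Fin π.length → X) :
    {x : Fin π.length → X | Function.Injective x}.indicator
        (fun x => ∏ i, ω.carrier.indicator v (x i) ^ π.partSize i) x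
      = (distinctTuples π.length ω).indicator (fun x => ∏ i, v (x i) ^ π.partSize i) x := by
  classical
  by_cases hx : x ∈ distinctTuples π.length ω
  · have hx1 : x ∈ {x : Fin π.length → X | Function.Injective x} := hx.1
    rw [Set.indicator_of_mem hx, Set.indicator_of_mem hx1]
    exact Finset.prod_congr rfl fun i _ => by rw [Set.indicator_of_mem (hx.2 i)]
  · rw [Set.indicator_of_notMem hx]
    by_cases hx1 : x ∈ {x : Fin π.length → X | Function.Injective x}
    · have : ∃ i, x i ∉ ω.carrier := by
        by_contra! h
        exact hx ⟨hx1, h⟩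
      obtain ⟨i, hi⟩ := this
      rw [Set.indicator_of_mem hx1]
      refine Finset.prod_eq_zero (Finset.mem_univ i) ?_
      rw [Set.indicator_of_notMem hi, zero_pow (π.partSize_pos i).ne']
    · rw [Set.indicator_of_notMem hx1]

theorem tsum_indicator_pow (ω : Config X) (v : X → ℝ≥0∞) (n : ℕ) :
    (∑' x, ω.carrier.indicator v x) ^ n = ∑ π : OrderedFinpartition n, ∑' x,
      (distinctTuples π.length ω).indicator (fun x => ∏ i, v (x i) ^ π.partSize i) x := by
  rw [tsum_pow_eq_tsum_weight, ENNReal.tsum_sigma', tsum_fintype]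
  refine Finset.sum_congr rfl fun π _ => ?_
  simp only [← indicator_weight]
  exact tsum_subtype {x : Fin π.length → X | Function.Injective x}
    fun x => ∏ i, ω.carrier.indicator v (x i) ^ π.partSize i

theorem summable_indicator_weight {ω : Config X} {v : X → ℝ}
    (hv : Summable (ω.carrier.indicator v)) {n : ℕ} (π : OrderedFinpartition n) :
    Summable ((distinctTuples π.length ω).indicator fun x => ∏ i, v (x i) ^ π.partSize i) := by
  have h := (hasSum_weight_pow hv n).summable.sigma_factor π
  rw [← funext (indicator_weight ω v π)]
  exact summable_subtype_iff_indicator.1 h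

theorem tsum_indicator_pow_real {ω : Config X} {v : X → ℝ}
    (hv : Summable (ω.carrier.indicator v)) (n : ℕ) :
    (∑' x, ω.carrier.indicator v x) ^ n = ∑ π : OrderedFinpartition n, ∑' x,
      (distinctTuples π.length ω).indicator (fun x => ∏ i, v (x i) ^ π.partSize i) x := by
  have h := hasSum_weight_pow hv n
  rw [← h.tsum_eq, h.summable.tsum_sigma, tsum_fintype]
  refine Finset.sum_congr rfl fun π _ => ?_
  simp only [← indicator_weight]
  exact tsum_subtype {x : Fin π.length → X | Function.Injective x}
    fun x => ∏ i, ω.carrier.indicator v (x i) ^ π.partSize i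

end Moments
-- Signed sums, integrability and expectations
section Expectation

variable {X : Type u} [TopologicalSpace X]

/-- This brings a signed sum into the form of two `ℝ≥0∞`-valued sums, to which the Mecke formula and
its measurability statement apply. -/
theorem tsum_indicator_eq_toReal_sub {Z : Type*} {s : Set Z} {g : Z → ℝ}
    (hg : Summable (s.indicator g)) :
    ∑' x, s.indicator g x = (∑' x, s.indicator (fun x => ENNReal.ofReal (g x)) x).toReal
      - (∑' x, s.indicator (fun x => ENNReal.ofReal (-g x)) x).toReal := by
  have hfin : ∀ x, s.indicator (fun x => ENNReal.ofReal (g x)) x ≠ ∞ := fun x => by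
    by_cases h : x ∈ s <;> simp [h]
  have hfin' : ∀ x, s.indicator (fun x => ENNReal.ofReal (-g x)) x ≠ ∞ := fun x => by
    by_cases h : x ∈ s <;> simp [h]
  have e1 : ∀ x, (s.indicator (fun x => ENNReal.ofReal (g x)) x).toReal
      = max (s.indicator g x) 0 := fun x => by
    by_cases h : x ∈ s <;> simp [h, ENNReal.toReal_ofReal']
  have e2 : ∀ x, (s.indicator (fun x => ENNReal.ofReal (-g x)) x).toReal
      = max (-s.indicator g x) 0 := fun x => by
    by_cases h : x ∈ s <;> simp [h, ENNReal.toReal_ofReal']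
  rw [ENNReal.tsum_toReal_eq hfin, ENNReal.tsum_toReal_eq hfin']
  simp only [e1, e2]
  have s1 : Summable fun x => max (s.indicator g x) 0 :=
    .of_nonneg_of_le (fun _ => le_max_right _ _)
      (fun x => max_le (le_abs_self _) (abs_nonneg _)) hg.abs
  have s2 : Summable fun x => max (-s.indicator g x) 0 :=
    .of_nonneg_of_le (fun _ => le_max_right _ _)
      (fun x => max_le (neg_le_abs _) (abs_nonneg _)) hg.abs
  rw [← s1.tsum_sub s2]
  refine tsum_congr fun x => ?_
  rcases le_total (s.indicator g x) 0 with h | h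
  · rw [max_eq_right h, max_eq_left (neg_nonneg.2 h)]
    ring
  · rw [max_eq_left h, max_eq_right (neg_nonpos.2 h)]
    ring

theorem momentIntegrand_eq (c : X → Config X → ℝ≥0) (u : X → Config X → ℝ) {k : ℕ}
    (b : Fin k → ℕ) (x : Fin k → X) (ω : Config X) :
    momentIntegrand c u b x ω
      = (∏ i, u (x i) (ω.addPoints x) ^ b i) * (compoundDensity c x ω : ℝ) := rfl

variable [MeasurableSpace X]

theorem Config.hasSum_integral_toMeasure [MeasurableSingletonClass X] {ω : Config X} {f : X → ℝ}
    (hf : Integrable f ω.toMeasure) :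
    HasSum (ω.carrier.indicator f) (∫ x, f x ∂ω.toMeasure) := by
  have h := hasSum_integral_measure hf
  simp only [integral_dirac] at h
  exact hasSum_subtype_iff_indicator.1 h

theorem measurable_apply_coordinate {Z : Type*} [MeasurableSpace Z]
    {u : X → Config X → Z} (hu : Measurable fun p : X × Config X => u p.1 p.2) {k : ℕ} (i : Fin k) :
    Measurable fun p : Config X × (Fin k → X) => u (p.2 i) p.1 := by
  have h : Measurable fun p : Config X × (Fin k → X) => (p.2 i, p.1) :=
    ((measurable_pi_apply i).comp measurable_snd).prodMk measurable_fst
  exact hu.comp h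

theorem integral_toMeasure_pow [MeasurableSingletonClass X] {ω : Config X} {f : X → ℝ}
    (hf : Integrable f ω.toMeasure) (n : ℕ) :
    (∫ x, f x ∂ω.toMeasure) ^ n = ∑ π : OrderedFinpartition n,
      ((∑' x, (distinctTuples π.length ω).indicator
          (fun x => ENNReal.ofReal (∏ i, f (x i) ^ π.partSize i)) x).toReal -
        (∑' x, (distinctTuples π.length ω).indicator
          (fun x => ENNReal.ofReal (-∏ i, f (x i) ^ π.partSize i)) x).toReal) := by
  have h := Config.hasSum_integral_toMeasure hf
  rw [← h.tsum_eq, tsum_indicator_pow_real h.summable n]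
  exact Finset.sum_congr rfl fun π _ =>
    tsum_indicator_eq_toReal_sub (summable_indicator_weight h.summable π)

variable [PolishSpace X] [BorelSpace X]

/-- The signed version of the multivariate Mecke formula, the sum over tuples of points being
written as the difference of its positive and negative parts. -/
theorem IsPapangelouDensity.integral_tsum_distinctTuples {σ : Measure X} [SigmaFinite σ]
    {P : Measure (Config X)} [IsProbabilityMeasure P] {c : X → Config X → ℝ≥0}
    (hc : IsPapangelouDensity σ P c) {k : ℕ} {F : Config X × (Fin k → X) → ℝ}
    (hF : Measurable F)
    (hint : Integrable (fun p : Config X × (Fin k → X) =>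
      F (p.1.addPoints p.2, p.2) * (compoundDensity c p.2 p.1 : ℝ))
      (P.prod (Measure.pi fun _ : Fin k => σ))) :
    Integrable (fun ω =>
        (∑' x, (distinctTuples k ω).indicator (fun x => ENNReal.ofReal (F (ω, x))) x).toReal -
        (∑' x, (distinctTuples k ω).indicator (fun x => ENNReal.ofReal (-F (ω, x))) x).toReal) P ∧
    ∫ ω, ((∑' x, (distinctTuples k ω).indicator (fun x => ENNReal.ofReal (F (ω, x))) x).toReal -
        (∑' x, (distinctTuples k ω).indicator (fun x => ENNReal.ofReal (-F (ω, x))) x).toReal) ∂P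
      = ∫ p : Config X × (Fin k → X), F (p.1.addPoints p.2, p.2) * (compoundDensity c p.2 p.1 : ℝ)
          ∂(P.prod (Measure.pi fun _ : Fin k => σ)) := by
  have key : ∀ {G : Config X × (Fin k → X) → ℝ}, Measurable G →
      ∫⁻ ω, ∑' x, (distinctTuples k ω).indicator (fun x => ENNReal.ofReal (G (ω, x))) x ∂P
        = ∫⁻ p, ENNReal.ofReal (G (p.1.addPoints p.2, p.2) * (compoundDensity c p.2 p.1 : ℝ))
          ∂(P.prod (Measure.pi fun _ : Fin k => σ)) := fun {G} hG => by
    rw [hc.lintegral_tsum_distinctTuples k (f := fun p => ENNReal.ofReal (G p)) hG.ennreal_ofReal]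
    refine lintegral_congr fun p => ?_
    rw [ENNReal.ofReal_mul' (NNReal.coe_nonneg _), ENNReal.ofReal_coe_nnreal]
  have hp := key hF
  have hm := key hF.neg
  simp only [Pi.neg_apply, neg_mul] at hm
  have hmp : Measurable fun ω =>
      ∑' x, (distinctTuples k ω).indicator (fun x => ENNReal.ofReal (F (ω, x))) x :=
    measurable_tsum_distinctTuples' hF.ennreal_ofReal
  have hmm : Measurable fun ω =>
      ∑' x, (distinctTuples k ω).indicator (fun x => ENNReal.ofReal (-F (ω, x))) x :=
    measurable_tsum_distinctTuples' hF.neg.ennreal_ofReal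
  have hp' : ∫⁻ ω, ∑' x, (distinctTuples k ω).indicator
      (fun x => ENNReal.ofReal (F (ω, x))) x ∂P ≠ ∞ := by
    rw [hp]
    exact hint.lintegral_lt_top.ne
  have hm' : ∫⁻ ω, ∑' x, (distinctTuples k ω).indicator
      (fun x => ENNReal.ofReal (-F (ω, x))) x ∂P ≠ ∞ := by
    rw [hm]
    exact hint.neg.lintegral_lt_top.ne
  have ip := integrable_toReal_of_lintegral_ne_top hmp.aemeasurable hp'
  have im := integrable_toReal_of_lintegral_ne_top hmm.aemeasurable hm'
  refine ⟨ip.sub im, ?_⟩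
  rw [integral_sub ip im, integral_toReal hmp.aemeasurable (ae_lt_top hmp hp'),
    integral_toReal hmm.aemeasurable (ae_lt_top hmm hm'), hp, hm,
    integral_eq_lintegral_pos_part_sub_lintegral_neg_part hint]

/-- After expansion and the Mecke formula, each partition contributes precisely the `L¹` norm of its
moment integrand, because absolute values are multiplicative. -/
theorem lintegral_pow_lt_top {σ : Measure X} [SigmaFinite σ] {P : Measure (Config X)}
    [IsProbabilityMeasure P] {c : X → Config X → ℝ≥0} (hc : IsPapangelouDensity σ P c)
    {u : X → Config X → ℝ} (hu : Measurable fun p : X × Config X => u p.1 p.2) {n : ℕ}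
    (hint : ∀ π : OrderedFinpartition n,
      Integrable (fun p : Config X × (Fin π.length → X) => momentIntegrand c u π.partSize p.2 p.1)
        (P.prod (Measure.pi fun _ : Fin π.length => σ))) :
    ∫⁻ ω, (∫⁻ x, ‖u x ω‖ₑ ∂ω.toMeasure) ^ n ∂P < ∞ := by
  have hw : ∀ π : OrderedFinpartition n, Measurable fun p : Config X × (Fin π.length → X) =>
      ∏ i, ‖u (p.2 i) p.1‖ₑ ^ π.partSize i := fun π =>
    Finset.measurable_prod _ fun i _ =>
      (measurable_apply_coordinate hu i).enorm.pow_const _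
  simp only [Config.lintegral_toMeasure, tsum_indicator_pow]
  rw [lintegral_finsetSum _ fun π _ => measurable_tsum_distinctTuples' (hw π)]
  refine ENNReal.sum_lt_top.2 fun π _ => ?_
  rw [hc.lintegral_tsum_distinctTuples _ (hw π)]
  refine (lintegral_congr fun p => ?_).trans_lt (hint π).2
  simp only [momentIntegrand_eq, enorm_eq_nnnorm, nnnorm_mul, nnnorm_prod, nnnorm_pow,
    NNReal.nnnorm_eq, ENNReal.coe_mul, ENNReal.ofNNReal_finsetProd, ENNReal.coe_pow]

theorem ae_integrable_toMeasure {P : Measure (Config X)} {u : X → Config X → ℝ}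
    (hu : Measurable fun p : X × Config X => u p.1 p.2) {n : ℕ} (hn : n ≠ 0)
    (hfin : ∫⁻ ω, (∫⁻ x, ‖u x ω‖ₑ ∂ω.toMeasure) ^ n ∂P < ∞) :
    ∀ᵐ ω ∂P, Integrable (fun x => u x ω) ω.toMeasure := by
  have hnorm : Measurable fun ω : Config X => ∫⁻ x, ‖u x ω‖ₑ ∂ω.toMeasure :=
    Config.measurable_lintegral_toMeasure_of_measurable (f := fun p => ‖u p.2 p.1‖ₑ)
      (hu.comp measurable_swap).enorm
  filter_upwards [ae_lt_top (hnorm.pow_const n) hfin.ne] with ω hω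
  refine ⟨(hu.comp measurable_prodMk_right).aestronglyMeasurable, ?_⟩
  have hω' : (∫⁻ x, ‖u x ω‖ₑ ∂ω.toMeasure) ^ n < ∞ := hω
  exact (ENNReal.pow_lt_top_iff.1 hω').resolve_right hn

end Expectation

end PointConfig

theorem proposition3p2 {X : Type*} [TopologicalSpace X] [PolishSpace X]
    [MeasurableSpace X] [BorelSpace X] (σ : Measure X) [SigmaFinite σ]
    (P : Measure (PointConfig.Config X)) [IsProbabilityMeasure P]
    (c : X → PointConfig.Config X → ℝ≥0) (hc : PointConfig.IsPapangelouDensity σ P c)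
    (u : X → PointConfig.Config X → ℝ)
    (hu : Measurable fun p : X × PointConfig.Config X => u p.1 p.2)
    (n : ℕ) (hn : 1 ≤ n)
    -- `π` runs over the partitions of an `n`-element set, with `π.length` blocks of
    -- cardinalities `π.partSize i`
    (hint : ∀ π : OrderedFinpartition n,
      Integrable (fun p : PointConfig.Config X × (Fin π.length → X) =>
          PointConfig.momentIntegrand c u π.partSize p.2 p.1)
        (P.prod (Measure.pi fun _ : Fin π.length => σ))) :
    (∀ᵐ ω ∂P, Integrable (fun x => u x ω) ω.toMeasure) ∧
    Integrable (fun ω => (∫ x, u x ω ∂ω.toMeasure) ^ n) P ∧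
    ∫ ω, (∫ x, u x ω ∂ω.toMeasure) ^ n ∂P =
      ∑ π : OrderedFinpartition n,
        ∫ ω, ∫ x : Fin π.length → X,
          PointConfig.momentIntegrand c u π.partSize x ω
            ∂(Measure.pi fun _ : Fin π.length => σ) ∂P := by
  have hae := PointConfig.ae_integrable_toMeasure hu (by omega : n ≠ 0)
    (PointConfig.lintegral_pow_lt_top hc hu hint)
  have hF : ∀ π : OrderedFinpartition n,
      Measurable fun p : PointConfig.Config X × (Fin π.length → X) =>
        ∏ i, u (p.2 i) p.1 ^ π.partSize i := fun π =>
    Finset.measurable_prod _ fun i _ =>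
      (PointConfig.measurable_apply_coordinate hu i).pow_const _
  have hM := fun π : OrderedFinpartition n => hc.integral_tsum_distinctTuples (hF π) (hint π)
  -- The pathwise expansion needs `u(·, ω)` integrable, hence holds only almost surely; that
  -- suffices for integrability and for the expectation.
  have heq := hae.mono fun ω hω => PointConfig.integral_toMeasure_pow hω n
  refine ⟨hae, (integrable_congr heq).2 (integrable_finsetSum _ fun π _ => (hM π).1), ?_⟩
  rw [integral_congr_ae heq, integral_finsetSum _ fun π _ => (hM π).1]
  refine Finset.sum_congr rfl fun π _ => ?_
  rw [(hM π).2]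
  exact integral_prod _ (hint π)
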